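/- Conventions. All logarithms are to base $2$. Let $n,m,d$ be nonnegative integers, $N=\{0,1\}^n$, $M=\{0,1\}^m$, $D=\{0,1\}^d$, and let $k,\varepsilon$ be real numbers. For $f:N\to M$ let $F$ be the $M\times N$ matrix with $F_{y,x}=1$ if $f(x)=y$ and $F_{y,x}=0$ otherwise. For a family $\mathrm{Ext}=\{f_s\}_{s\in D}$ of functions $f_s:N\to M$, let $F_s$ be the matrix of $f_s$. The family $\mathrm{Ext}$ is a $(k,\varepsilon)$-extractor if for every probability distribution $P$ on $N$ with $H_{\min}(N)_P:=-\log\max_x P(x)\ge k$, $$\Big\|\frac1{2^d}\sum_{s\in D}F_sP-\upsilon_M\Big\|_{\ell_1}\le\varepsilon ,$$ where $\upsilon_M$ is the uniform distribution on $M$. A classical-quantum state on $Q\otimes N$, with $Q$ a finite-dimensional complex inner-product space, is a positive semidefinite operator of trace $1$ of the form $\rho_{QN}=\sum_{x\in N}\rho_x\otimes|x\rangle\langle x|$ with all $\rho_x\ge0$; put $\rho_Q=\sum_x\rho_x$ and $$H_{\min}(N|Q)_\rho:=-\log\inf_{\sigma}\big\|(\sigma^{-1/2}\otimes 1_N)\,\rho_{QN}\,(\sigma^{-1/2}\otimes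 1_N)\big\|_\infty ,$$ where $\sigma$ ranges over the states (positive semidefinite operators of trace $1$) on $Q$ whose support contains the support of $\rho_Q$, the inverse is the generalized inverse, and $\|\cdot\|_\infty$ is the operator norm. The family $\mathrm{Ext}$ is a quantum-proof $(k,\varepsilon)$-extractor if for every finite-dimensional $Q$ and every classical-quantum state $\rho_{QN}$ with $H_{\min}(N|Q)_\rho\ge k$, $$\Big\|\frac1{2^d}\sum_{s\in D}(\mathrm{id}_Q\otimes F_s)(\rho_{QN})-\rho_Q\otimes\upsilon_M\Big\|_1\le\varepsilon ,$$ where $\|A\|_1=\mathrm{Tr}\sqrt{A^*A}$ is the trace norm, $(\mathrm{id}_Q\otimes F_s)(\rho_{QN})=\sum_x\rho_x\otimes|f_s(x)\rangle\langle f_s(x)|$, and $\upsilon_M$ is identified with the maximally mixed state on $M$. Statement. Every $(k,\varepsilon)$-extractor $\{f_s:\{0,1\}^n\to\{0,1\}^m\}_{s\in\{0,1\}^d}$ is a quantum-proof $\big(k+1,\,6\sqrt{2^m}\,\varepsilon\big)$-extractor. -/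

import Mathlib

open scoped Matrix Kronecker ComplexOrder

/-- Bit strings of length `n`, a system of dimension `2 ^ n`. -/
abbrev BitString (n : ℕ) : Type := Fin n → Bool

namespace QExt

noncomputable section

/-! ## Classical extractors -/

/-- `P` is a probability distribution on the finite set `N`. -/
def IsProbDist {N : Type*} [Fintype N] (P : N → ℝ) : Prop :=
  (∀ x, 0 ≤ P x) ∧ ∑ x, P x = 1

/-- The min-entropy `-log₂ max_x P(x)` of a probability distribution. -/
def minEntropy {N : Type*} (P : N → ℝ) : ℝ :=
  -Real.logb 2 (⨆ x, P x)

/-- The `M × N` matrix of a function `f : N → M`: the entry `(y, x)` is one if `f x = y` and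
zero otherwise. -/
def funMatrix (R : Type*) [Zero R] [One R] {N M : Type*} [DecidableEq M] (f : N → M) :
    Matrix M N R :=
  Matrix.of fun y x => if f x = y then 1 else 0

/-- The family `f` of functions `N → M`, indexed by the seeds in `D`, is a (weak)
`(k, ε)`-extractor: on every input distribution of min-entropy at least `k`, the output under a
uniform seed is `ε`-close in `ℓ₁`-norm to the uniform distribution. -/
def IsExtractor {D N M : Type*} [Fintype D] [Fintype N] [Fintype M] [DecidableEq M]
    (f : D → N → M) (k ε : ℝ) : Prop :=
  ∀ P : N → ℝ, IsProbDist P → k ≤ minEntropy P →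
    ∑ y, |((1 / (Fintype.card D : ℝ)) • ∑ s, funMatrix ℝ (f s) *ᵥ P) y
      - 1 / (Fintype.card M : ℝ)| ≤ ε

/-! ## Quantum systems -/

/-- The trace norm `Tr √(A* A)`. -/
def traceNorm {ι : Type*} [Fintype ι] [DecidableEq ι] (A : Matrix ι ι ℂ) : ℝ :=
  (cfc Real.sqrt (Aᴴ * A)).trace.re

open scoped Matrix.Norms.L2Operator in
/-- The operator norm (largest singular value). -/
def opNorm {ι : Type*} [Fintype ι] [DecidableEq ι] (A : Matrix ι ι ℂ) : ℝ := ‖A‖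

/-- States of a system: positive semidefinite matrices of trace one. -/
def IsState {ι : Type*} [Fintype ι] (ρ : Matrix ι ι ℂ) : Prop :=
  ρ.PosSemidef ∧ ρ.trace = 1

/-- Classical-quantum states: states of the form `∑ₓ ρₓ ⊗ |x⟩⟨x|` with `ρₓ` positive
semidefinite. -/
def IsCQState {Q N : Type*} [Fintype Q] [Fintype N] [DecidableEq N]
    (ρ : Matrix (Q × N) (Q × N) ℂ) : Prop :=
  IsState ρ ∧ ∃ r : N → Matrix Q Q ℂ, (∀ x, (r x).PosSemidef) ∧
    ρ = ∑ x, r x ⊗ₖ Matrix.single x x (1 : ℂ)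

/-- The marginal `ρ_Q = Tr_N ρ_{QN}`. -/
def marginal {Q N : Type*} [Fintype N] (ρ : Matrix (Q × N) (Q × N) ℂ) : Matrix Q Q ℂ :=
  Matrix.of fun i j => ∑ x, ρ (i, x) (j, x)

/-- The generalized inverse square root `σ^{-1/2}` of a positive semidefinite matrix: the
eigenvalue `0` is sent to `0`. -/
def invSqrt {Q : Type*} [Fintype Q] [DecidableEq Q] (σ : Matrix Q Q ℂ) : Matrix Q Q ℂ :=
  cfc (fun t : ℝ => (√t)⁻¹) σ

/-- The conditional min-entropy
`H_min(N|Q)_ρ = -log₂ inf_σ ‖(σ^{-1/2} ⊗ 1) ρ (σ^{-1/2} ⊗ 1)‖_∞`, the infimum being over the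
states `σ` of `Q` whose support contains the support of `ρ_Q` (that is, `ker σ ⊆ ker ρ_Q`), as is
needed for the generalized inverse to make sense. -/
def condMinEntropy {Q N : Type*} [Fintype Q] [DecidableEq Q] [Fintype N] [DecidableEq N]
    (ρ : Matrix (Q × N) (Q × N) ℂ) : ℝ :=
  -Real.logb 2 (sInf {t : ℝ | ∃ σ : Matrix Q Q ℂ, IsState σ ∧
    (∀ v : Q → ℂ, σ *ᵥ v = 0 → marginal ρ *ᵥ v = 0) ∧
    t = opNorm ((invSqrt σ ⊗ₖ (1 : Matrix N N ℂ)) * ρ * (invSqrt σ ⊗ₖ (1 : Matrix N N ℂ)))})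

/-- The map `id_Q ⊗ F` for a matrix `F` acting on the classical system `N`:
it sends `∑ₓ ρₓ ⊗ |x⟩⟨x|` to `∑_y (∑ₓ F_{yx} ρₓ) ⊗ |y⟩⟨y|`. -/
def idTensor {Q N M : Type*} [Fintype N] [DecidableEq M] (F : Matrix M N ℂ)
    (ρ : Matrix (Q × N) (Q × N) ℂ) : Matrix (Q × M) (Q × M) ℂ :=
  Matrix.of fun a b => if a.2 = b.2 then ∑ x, F a.2 x * ρ (a.1, x) (b.1, x) else 0

/-- The maximally mixed state. -/
def maxMixed (M : Type*) [Fintype M] [DecidableEq M] : Matrix M M ℂ :=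
  (1 / (Fintype.card M : ℂ)) • (1 : Matrix M M ℂ)

/-- The family `f` of functions `N → M`, indexed by the seeds in `D`, is a quantum-proof
`(k, ε)`-extractor: the quantum system `Q` has arbitrary finite dimension `q`. -/
def IsQuantumProofExtractor {D N M : Type*} [Fintype D] [Fintype N] [DecidableEq N]
    [Fintype M] [DecidableEq M] (f : D → N → M) (k ε : ℝ) : Prop :=
  ∀ (q : ℕ) (ρ : Matrix (Fin q × N) (Fin q × N) ℂ), IsCQState ρ → k ≤ condMinEntropy ρ →
    traceNorm ((1 / (Fintype.card D : ℂ)) • ∑ s, idTensor (funMatrix ℂ (f s)) ρ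
      - marginal ρ ⊗ₖ maxMixed M) ≤ ε

end

end QExt

namespace QExt

/-! ## Classical extractors as bounds on a matrix -/

/-! A quantum input is tested against the classical hypothesis through quadratic forms. The entropy
bound gives a state `σ` and `t`, about `2 ^ (-(k + 1))`, with all blocks `r x ≤ t σ`. For `τ`,
roughly the average of `σ` and `ρ_Q`, both `r x ≤ 2 t τ` and `∑ r x ≤ 2 τ`; this doubling costs the
one bit of entropy. Write `τ = Sᴴ S` and `r x = Sᴴ ω x S`. For each vector `v` the numbers `⟨v, ω x
v⟩` form a classical weight with bounded entries and total mass, so the extractor bounds the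
numerical radius, hence the operator norm, of every signed sum `∑ y, z y • B y` with `B y = ∑ x,
bias f y x • ω x`.

The output error has blocks `Sᴴ B y S`. Cauchy–Schwarz bounds its trace norm by `√(|M| tr τ)` times
the Frobenius norm of the family `B y S`; some choice of signs bounds that norm by the one of a
single signed sum. This is `traceNorm_blockDiagonal_le`. Passing from distributions to weights of
other mass is `abs_sum_le_of_bounded_on_probDist`. -/

/-- The matrix of the averaged map `F` minus the projection onto the uniform distribution. -/
noncomputable def bias {D N M : Type*} [Fintype D] [Fintype M] [DecidableEq M]
    (f : D → N → M) (y : M) (x : N) : ℝ :=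
  1 / (Fintype.card D : ℝ) * ∑ s, (if f s x = y then 1 else 0) - 1 / (Fintype.card M : ℝ)

theorem le_minEntropy {N : Type*} [Fintype N] {P : N → ℝ} (hP : IsProbDist P) {k : ℝ}
    (h : ∀ x, P x ≤ (2 : ℝ) ^ (-k)) : k ≤ minEntropy P := by
  have hne : Nonempty N := by
    by_contra hN
    rw [not_nonempty_iff] at hN
    simpa using hP.2
  -- `logb` takes a default value at `0`, so its monotonicity needs a positive maximum.
  have hpos : 0 < ⨆ x, P x := by
    obtain ⟨x, hx⟩ : ∃ x, 0 < P x := by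
      by_contra! hx
      have := Finset.sum_nonpos (fun x (_ : x ∈ Finset.univ) => hx x)
      linarith [hP.2]
    exact hx.trans_le (le_ciSup (Set.finite_range P).bddAbove x)
  have := (Real.logb_le_iff_le_rpow one_lt_two hpos).2 (ciSup_le h)
  unfold minEntropy
  linarith

theorem IsExtractor.sum_abs_bias_le {D N M : Type*} [Fintype D] [Fintype N] [Fintype M]
    [DecidableEq M] {f : D → N → M} {k ε : ℝ} (hf : IsExtractor f k ε) {P : N → ℝ}
    (hP : IsProbDist P) (h : ∀ x, P x ≤ (2 : ℝ) ^ (-k)) :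
    ∑ y, |∑ x, bias f y x * P x| ≤ ε := by
  refine le_of_eq_of_le (Finset.sum_congr rfl fun y _ => ?_) (hf P hP (le_minEntropy hP h))
  congr 1
  simp only [bias, sub_mul, Finset.sum_sub_distrib, ← Finset.mul_sum, hP.2, mul_one,
    Pi.smul_apply, Finset.sum_apply, smul_eq_mul, Matrix.mulVec, dotProduct, funMatrix,
    Matrix.of_apply, mul_assoc, Finset.sum_mul]
  rw [Finset.sum_comm]

theorem IsExtractor.abs_sum_signed_bias_le {D N M : Type*} [Fintype D] [Fintype N] [Fintype M]
    [DecidableEq M] {f : D → N → M} {k ε : ℝ} (hf : IsExtractor f k ε) {z : M → ℝ}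
    (hz : ∀ y, |z y| = 1) {P : N → ℝ} (hP : IsProbDist P) (h : ∀ x, P x ≤ (2 : ℝ) ^ (-k)) :
    |∑ x, (∑ y, z y * bias f y x) * P x| ≤ ε := by
  refine le_trans ?_ (hf.sum_abs_bias_le hP h)
  have : ∑ x, (∑ y, z y * bias f y x) * P x = ∑ y, z y * ∑ x, bias f y x * P x := by
    simp only [Finset.sum_mul, Finset.mul_sum, mul_assoc]
    rw [Finset.sum_comm]
  rw [this]
  refine (Finset.abs_sum_le_sum_abs _ _).trans (le_of_eq (Finset.sum_congr rfl fun y _ => ?_))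
  rw [abs_mul, hz, one_mul]

/-- A functional that is bounded on the probability distributions with entries at most `b` is
bounded on the nonnegative vectors with entries at most `b` and sum at most `20 / 11`. -/
theorem abs_sum_le_of_bounded_on_probDist {N : Type*} [Fintype N] {c : N → ℝ} {b ε : ℝ}
    (h : ∀ P : N → ℝ, IsProbDist P → (∀ x, P x ≤ b) → |∑ x, c x * P x| ≤ ε)
    (hb : 20 / 11 ≤ Fintype.card N * b) {w : N → ℝ} (hw0 : ∀ x, 0 ≤ w x) (hwb : ∀ x, w x ≤ b)
    (hw : ∑ x, w x ≤ 20 / 11) : |∑ x, c x * w x| ≤ 40 / 9 * ε := by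
  have hN : (0 : ℝ) < Fintype.card N := by
    by_contra hN
    have : (Fintype.card N : ℝ) = 0 := le_antisymm (not_lt.1 hN) (Nat.cast_nonneg _)
    rw [this] at hb
    norm_num at hb
  set L : ℝ := Fintype.card N * b with hL
  have hb0 : 0 < b := by
    by_contra hb0
    nlinarith [mul_nonneg hN.le (neg_nonneg.2 (not_lt.1 hb0))]
  set s := ∑ x, w x with hs
  have hs0 : 0 ≤ s := Finset.sum_nonneg fun x _ => hw0 x
  -- The uniform distribution is admissible because `1 ≤ |N| b`.
  have hu : |∑ x, c x| ≤ Fintype.card N * ε := by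
    have := h (fun _ => (Fintype.card N : ℝ)⁻¹) ⟨fun _ => by positivity, by
      simp [hN.ne']⟩ (fun _ => by
        rw [inv_le_iff_one_le_mul₀ hN]; linarith)
    rw [← Finset.sum_mul, abs_mul, abs_of_pos (inv_pos.2 hN), ← div_eq_mul_inv,
      div_le_iff₀ hN] at this
    linarith
  have hε : 0 ≤ ε := by
    by_contra hε
    have := (abs_nonneg _).trans hu
    nlinarith
  rcases le_or_gt 1 s with h1 | h1
  · have hs1 : 0 < s := by linarith
    have := h (fun x => w x / s) ⟨fun x => div_nonneg (hw0 x) hs0, by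
      rw [← Finset.sum_div]; exact div_self hs1.ne'⟩ (fun x => by
        rw [div_le_iff₀ hs1]; nlinarith [hwb x])
    simp only [← mul_div_assoc, ← Finset.sum_div, abs_div, abs_of_pos hs1] at this
    rw [div_le_iff₀ hs1] at this
    nlinarith
  · have hLs : 0 < L - s := by linarith
    -- Mass below one: moving `w` a fraction `t` of the way to the constant `b` gives a
    -- distribution; the constant part is controlled by `hu`.
    set t := (1 - s) / (L - s) with ht
    have ht0 : 0 ≤ t := div_nonneg (by linarith) hLs.le
    have htm : t * (L - s) = 1 - s := div_mul_cancel₀ _ hLs.ne'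
    have ht1 : t ≤ 1 := by rw [ht, div_le_one hLs]; linarith
    have hp := h (fun x => w x + t * (b - w x))
      ⟨fun x => add_nonneg (hw0 x) (mul_nonneg ht0 (sub_nonneg.2 (hwb x))), by
        simp only [Finset.sum_add_distrib, ← Finset.mul_sum, Finset.sum_sub_distrib, ← hs,
          Finset.sum_const, Finset.card_univ, nsmul_eq_mul, ← hL]
        linarith⟩
      (fun x => by nlinarith [hwb x])
    have he : (1 - t) * ∑ x, c x * w x
        = ∑ x, c x * (w x + t * (b - w x)) - t * b * ∑ x, c x := by
      rw [Finset.mul_sum, Finset.mul_sum, ← Finset.sum_sub_distrib]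
      exact Finset.sum_congr rfl fun x _ => by ring
    have h2 : (1 - t) * |∑ x, c x * w x| ≤ ε + t * L * ε := by
      rw [← abs_of_nonneg (sub_nonneg.2 ht1), ← abs_mul, he]
      refine (abs_sub _ _).trans (add_le_add hp ?_)
      rw [abs_mul, abs_of_nonneg (mul_nonneg ht0 hb0.le)]
      calc t * b * |∑ x, c x| ≤ t * b * (Fintype.card N * ε) := by gcongr
        _ = t * L * ε := by rw [hL]; ring
    have hA : (1 - t) * (L - s) = L - 1 := by linarith
    have hB : (L - 1) * |∑ x, c x * w x| ≤ ((L - s) + (1 - s) * L) * ε := by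
      calc (L - 1) * |∑ x, c x * w x| = (L - s) * ((1 - t) * |∑ x, c x * w x|) := by
            rw [← hA]; ring
        _ ≤ (L - s) * (ε + t * L * ε) := by gcongr
        _ = ((L - s) + (t * (L - s)) * L) * ε := by ring
        _ = _ := by rw [htm]
    -- The worst case is `s = 0`, `L = 20 / 11`, where `2 L / (L - 1) = 40 / 9`.
    have hC : ((L - s) + (1 - s) * L) * ε ≤ (L - 1) * (40 / 9 * ε) := by
      rw [← mul_assoc (L - 1)]
      refine mul_le_mul_of_nonneg_right ?_ hε
      nlinarith
    exact le_of_mul_le_mul_left (hB.trans hC) (by linarith)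

/-- Dividing by `11 / 10 * r` restores the entry bound `b` and turns mass `2 r` into `20 / 11`. -/
theorem abs_sum_le_of_bounded_on_probDist_of_scale {N : Type*} [Fintype N] {c : N → ℝ} {b ε : ℝ}
    (h : ∀ P : N → ℝ, IsProbDist P → (∀ x, P x ≤ b) → |∑ x, c x * P x| ≤ ε)
    (hb : 20 / 11 ≤ Fintype.card N * b) {w : N → ℝ} {r : ℝ} (hr : 0 ≤ r) (hw0 : ∀ x, 0 ≤ w x)
    (hwb : ∀ x, w x ≤ 11 / 10 * b * r) (hw : ∑ x, w x ≤ 2 * r) :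
    |∑ x, c x * w x| ≤ 44 / 9 * ε * r := by
  rcases hr.eq_or_lt with rfl | hr
  · have : ∀ x, w x = 0 := fun x => le_antisymm (by simpa using hwb x) (hw0 x)
    simp [this]
  · have hr' : 0 < 11 / 10 * r := by positivity
    have := abs_sum_le_of_bounded_on_probDist h hb (w := fun x => w x / (11 / 10 * r))
      (fun x => div_nonneg (hw0 x) hr'.le)
      (fun x => by rw [div_le_iff₀ hr']; linarith [hwb x])
      (by rw [← Finset.sum_div, div_le_iff₀ hr']; linarith)
    simp only [← mul_div_assoc, ← Finset.sum_div, abs_div, abs_of_pos hr'] at this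
    rw [div_le_iff₀ hr'] at this
    linarith

/-! ## The Frobenius norm -/

/-- The square of the Frobenius norm. -/
noncomputable def frobSq {m n : Type*} [Fintype m] [Fintype n] (A : Matrix m n ℂ) : ℝ :=
  ∑ i, ∑ j, ‖A i j‖ ^ 2

section frobSq

variable {m n : Type*} [Fintype m] [Fintype n]

theorem trace_conjTranspose_mul_self_re (A : Matrix m n ℂ) :
    (Aᴴ * A).trace.re = frobSq A := by
  simp only [Matrix.trace, Matrix.diag_apply, Matrix.mul_apply, Matrix.conjTranspose_apply,
    frobSq, Complex.re_sum]
  rw [Finset.sum_comm]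
  refine Finset.sum_congr rfl fun i _ => Finset.sum_congr rfl fun j _ => ?_
  rw [Complex.star_def, Complex.conj_mul', ← Complex.ofReal_pow, Complex.ofReal_re]

theorem frobSq_nonneg (A : Matrix m n ℂ) : 0 ≤ frobSq A := by
  unfold frobSq; positivity

theorem trace_conjTranspose_mul_re_le (A B : Matrix m n ℂ) :
    (Aᴴ * B).trace.re ≤ √(frobSq A) * √(frobSq B) := by
  have h : (Aᴴ * B).trace.re ≤ ∑ p : m × n, ‖A p.1 p.2‖ * ‖B p.1 p.2‖ := by
    simp only [Matrix.trace, Matrix.diag_apply, Matrix.mul_apply, Matrix.conjTranspose_apply,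
      Complex.re_sum, Fintype.sum_prod_type]
    rw [Finset.sum_comm]
    refine Finset.sum_le_sum fun i _ => Finset.sum_le_sum fun j _ => ?_
    exact (Complex.re_le_norm _).trans_eq (by rw [norm_mul, norm_star])
  refine h.trans ((Real.sum_mul_le_sqrt_mul_sqrt _ _ _).trans_eq ?_)
  simp only [frobSq, Fintype.sum_prod_type]

theorem frobSq_add_add_frobSq_sub (A B : Matrix m n ℂ) :
    frobSq (A + B) + frobSq (A - B) = 2 * (frobSq A + frobSq B) := by
  simp only [frobSq, ← Finset.sum_add_distrib, Finset.mul_sum, Matrix.add_apply, Matrix.sub_apply]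
  refine Finset.sum_congr rfl fun i _ => Finset.sum_congr rfl fun j _ => ?_
  have := parallelogram_law_with_norm ℝ (A i j) (B i j)
  nlinarith

/-- Some choice of signs does not decrease the sum of the squared norms. -/
theorem exists_signs_sum_frobSq_le {ι : Type*} [DecidableEq ι] (s : Finset ι)
    (A : ι → Matrix m n ℂ) :
    ∃ z : ι → ℝ, (∀ i, |z i| = 1) ∧ ∑ i ∈ s, frobSq (A i) ≤ frobSq (∑ i ∈ s, (z i : ℂ) • A i) := by
  induction s using Finset.induction_on with
  | empty => exact ⟨fun _ => 1, by simp, by simp [frobSq_nonneg]⟩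
  | insert a s ha ih =>
    obtain ⟨z, hz, hs⟩ := ih
    have key : ∀ e : ℝ, |e| = 1 →
        frobSq (A a) + ∑ i ∈ s, frobSq (A i) ≤ frobSq ((e : ℂ) • A a + ∑ i ∈ s, (z i : ℂ) • A i) →
        ∃ z : ι → ℝ, (∀ i, |z i| = 1) ∧
          ∑ i ∈ insert a s, frobSq (A i) ≤ frobSq (∑ i ∈ insert a s, (z i : ℂ) • A i) := by
      intro e he h
      refine ⟨Function.update z a e, fun i => ?_, ?_⟩
      · by_cases hi : i = a
        · subst hi; simpa using he
        · simpa [hi] using hz i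
      · rw [Finset.sum_insert ha, Finset.sum_insert ha, Function.update_self]
        have : ∑ i ∈ s, ((Function.update z a e i : ℝ) : ℂ) • A i = ∑ i ∈ s, (z i : ℂ) • A i :=
          Finset.sum_congr rfl fun i hi => by
            rw [Function.update_of_ne (ne_of_mem_of_not_mem hi ha)]
        rwa [this]
    -- By the parallelogram law, the larger of the two choices is at least the average.
    have hp := frobSq_add_add_frobSq_sub (∑ i ∈ s, (z i : ℂ) • A i) (A a)
    rcases le_total (frobSq (∑ i ∈ s, (z i : ℂ) • A i + A a))
      (frobSq (∑ i ∈ s, (z i : ℂ) • A i - A a)) with h | h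
    · refine key (-1) (by simp) ?_
      rw [show ((-1 : ℝ) : ℂ) • A a + ∑ i ∈ s, (z i : ℂ) • A i
        = ∑ i ∈ s, (z i : ℂ) • A i - A a by push_cast; rw [neg_one_smul]; abel]
      linarith
    · refine key 1 (by simp) ?_
      rw [show ((1 : ℝ) : ℂ) • A a + ∑ i ∈ s, (z i : ℂ) • A i
        = ∑ i ∈ s, (z i : ℂ) • A i + A a by push_cast; rw [one_smul]; abel]
      linarith

end frobSq

/-- A Hermitian matrix whose numerical radius is at most `K` contracts norms by `K`. -/
theorem frobSq_mul_le {m n : Type*} [Fintype m] [Fintype n] {C : Matrix m m ℂ}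
    (hC : C.IsHermitian) {K : ℝ} (hK : 0 ≤ K)
    (h : ∀ v : m → ℂ, |(star v ⬝ᵥ C *ᵥ v).re| ≤ K * (star v ⬝ᵥ v).re) (S : Matrix m n ℂ) :
    frobSq (C * S) ≤ K ^ 2 * frobSq S := by
  have hsq : ∀ v : m → ℂ, (star v ⬝ᵥ v).re = ∑ i, ‖v i‖ ^ 2 := fun v => by
    simp only [dotProduct, Pi.star_apply, Complex.re_sum]
    refine Finset.sum_congr rfl fun i _ => ?_
    rw [Complex.star_def, Complex.conj_mul', ← Complex.ofReal_pow, Complex.ofReal_re]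
  have hv : ∀ v : m → ℂ, ∑ i, ‖(C *ᵥ v) i‖ ^ 2 ≤ K ^ 2 * ∑ i, ‖v i‖ ^ 2 := by
    intro v
    rw [← hsq, ← hsq]
    set u := C *ᵥ v with hu
    have hua : star v ⬝ᵥ C *ᵥ u = star u ⬝ᵥ u := by
      rw [hu, Matrix.star_mulVec, hC.eq, Matrix.dotProduct_mulVec]
    have hub : star u ⬝ᵥ C *ᵥ v = star u ⬝ᵥ u := rfl
    have hsymm : (star u ⬝ᵥ v).re = (star v ⬝ᵥ u).re := by
      rw [show star u ⬝ᵥ v = star (star v ⬝ᵥ u) by rw [Matrix.star_dotProduct]]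
      simp
    -- Polarization: the forms of `C` at `u + t v` and `u - t v` differ by `4 t ‖u‖²`. The choice `t
    -- = K` is optimal.
    have key : ∀ t : ℝ, 4 * t * (star u ⬝ᵥ u).re
        ≤ 2 * K * ((star u ⬝ᵥ u).re + t ^ 2 * (star v ⬝ᵥ v).re) := by
      intro t
      have h1 := (abs_le.1 (h (u + (t : ℂ) • v))).2
      have h2 := (abs_le.1 (h (u - (t : ℂ) • v))).1
      simp only [Matrix.mulVec_add, Matrix.mulVec_sub, Matrix.mulVec_smul, star_add, star_sub,
        star_smul, dotProduct_add, dotProduct_sub, add_dotProduct, sub_dotProduct,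
        smul_dotProduct, dotProduct_smul, hua, hub, Complex.star_def, Complex.conj_ofReal,
        smul_eq_mul, Complex.add_re, Complex.sub_re, Complex.re_ofReal_mul, hsymm] at h1 h2
      linarith
    have hu0 : 0 ≤ (star v ⬝ᵥ v).re := by rw [hsq]; positivity
    rcases hK.eq_or_lt with rfl | hK
    · have := key 1; linarith
    · have := key K
      have h3 : 2 * K * (star u ⬝ᵥ u).re ≤ 2 * K * (K ^ 2 * (star v ⬝ᵥ v).re) := by linarith
      exact le_of_mul_le_mul_left h3 (by positivity)
  simp only [frobSq]
  rw [Finset.sum_comm, Finset.sum_comm (γ := m), Finset.mul_sum]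
  exact Finset.sum_le_sum fun j _ => hv fun i => S i j

/-! ## The trace norm -/

/-- The trace norm of a Hermitian matrix is attained at a Hermitian unitary. -/
theorem exists_traceNorm_eq {ι : Type*} [Fintype ι] [DecidableEq ι] {A : Matrix ι ι ℂ}
    (hA : A.IsHermitian) :
    ∃ U : Matrix ι ι ℂ, U.IsHermitian ∧ U * U = 1 ∧ traceNorm A = (U * A).trace.re := by
  have hsa : IsSelfAdjoint A := hA
  -- The value at `0` is `1`, not `0`, so that `U` is invertible.
  set g : ℝ → ℝ := fun t => if 0 ≤ t then 1 else -1 with hg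
  have hcont : ∀ h : ℝ → ℝ, ContinuousOn h (spectrum ℝ A) := fun h =>
    (Matrix.finite_real_spectrum).continuousOn h
  refine ⟨cfc g A, cfc_predicate g A, ?_, ?_⟩
  · rw [← cfc_mul g g A (hcont _) (hcont _)]
    rw [show (fun x => g x * g x) = fun _ => (1 : ℝ) by
      funext x; simp only [hg]; split_ifs <;> norm_num]
    exact cfc_const_one ℝ A
  · unfold traceNorm
    rw [hA.eq]
    have h1 : A * A = cfc (fun t : ℝ => t ^ 2) A := by
      rw [cfc_pow_id (R := ℝ) A 2, sq]
    rw [h1, ← cfc_comp' Real.sqrt (fun t : ℝ => t ^ 2) A]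
    have h2 : cfc g A * A = cfc (fun t => g t * t) A := by
      rw [cfc_mul g (fun t => t) A (hcont _) (hcont _), cfc_id' ℝ A]
    rw [h2]
    congr 3
    funext t
    rw [Real.sqrt_sq_eq_abs]
    simp only [hg]
    split_ifs with h
    · rw [abs_of_nonneg h, one_mul]
    · rw [abs_of_neg (not_le.1 h), neg_one_mul]

open scoped MatrixOrder Matrix.Norms.L2Operator in
theorem posSemidef_opNorm_smul_one_sub {ι : Type*} [Fintype ι] [DecidableEq ι]
    {A : Matrix ι ι ℂ} (hA : A.IsHermitian) : ((opNorm A : ℂ) • 1 - A).PosSemidef := by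
  have hsa : IsSelfAdjoint A := hA
  have := hsa.le_algebraMap_norm_self
  rw [Matrix.le_iff, Algebra.algebraMap_eq_smul_one] at this
  simpa [opNorm, Complex.coe_smul] using this

/-! ### Square roots and the operator order -/

section sqrtMatrices

variable {Q : Type*} [Fintype Q] [DecidableEq Q] {σ : Matrix Q Q ℂ}

theorem continuousOn_spectrum (σ : Matrix Q Q ℂ) (g : ℝ → ℝ) : ContinuousOn g (spectrum ℝ σ) :=
  Matrix.finite_real_spectrum.continuousOn g

/-- If `ρ` vanishes on the kernel of `σ` and `σ^{-1/2} ρ σ^{-1/2} ≤ t`, then `ρ ≤ t σ`. -/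
theorem posSemidef_smul_sub_of_invSqrt (hσ : σ.PosSemidef) {ρ : Matrix Q Q ℂ}
    (hρ : ρ.IsHermitian) (hker : ∀ v, σ *ᵥ v = 0 → ρ *ᵥ v = 0) {t : ℂ}
    (h : (t • 1 - invSqrt σ * ρ * invSqrt σ).PosSemidef) : (t • σ - ρ).PosSemidef := by
  have hc := continuousOn_spectrum σ
  have hsa : IsSelfAdjoint σ := hσ.1
  set R := cfc Real.sqrt σ with hR
  have hRh : Rᴴ = R := cfc_predicate Real.sqrt σ
  have hnn : ∀ x ∈ spectrum ℝ σ, 0 ≤ x := by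
    rw [hσ.1.spectrum_real_eq_range_eigenvalues]
    rintro _ ⟨i, rfl⟩
    exact hσ.eigenvalues_nonneg i
  have hRR : R * R = σ := by
    rw [hR, ← cfc_mul _ _ σ (hc _) (hc _)]
    conv_rhs => rw [← cfc_id ℝ σ]
    exact cfc_congr fun x hx => Real.mul_self_sqrt (hnn x hx)
  have hIh : (invSqrt σ)ᴴ = invSqrt σ := cfc_predicate (fun t : ℝ => (√t)⁻¹) σ
  -- `invSqrt σ * R` is the support projection of `σ`; the kernel condition makes it fix `ρ` too.
  have hσP : σ * (invSqrt σ * R) = σ := by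
    have : σ * (invSqrt σ * R) = cfc (fun x : ℝ => x * ((√x)⁻¹ * √x)) σ := by
      rw [cfc_mul (fun x : ℝ => x) _ σ (hc _) (hc _), cfc_mul _ _ σ (hc _) (hc _), cfc_id' ℝ σ]
      rfl
    rw [this]
    conv_rhs => rw [← cfc_id ℝ σ]
    refine cfc_congr fun x hx => ?_
    rcases (hnn x hx).eq_or_lt with rfl | hx
    · simp
    · simp [(Real.sqrt_pos.2 hx).ne']
  have hρP : ρ * (invSqrt σ * R) = ρ := by
    rw [← sub_eq_zero, ← Matrix.mul_one ρ, Matrix.mul_assoc, ← Matrix.mul_sub, Matrix.one_mul]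
    have h0 : σ * (invSqrt σ * R - 1) = 0 := by rw [Matrix.mul_sub, hσP, Matrix.mul_one, sub_self]
    ext i j
    have := congrFun (hker (fun k => (invSqrt σ * R - 1) k j)
      (funext fun i => congrFun (congrFun h0 i) j)) i
    exact this
  have hPρ : R * invSqrt σ * ρ = ρ := by
    have := congrArg Matrix.conjTranspose hρP
    rwa [Matrix.conjTranspose_mul, Matrix.conjTranspose_mul, hRh, hIh, hρ.eq] at this
  have := h.conjTranspose_mul_mul_same R
  rw [hRh, Matrix.mul_sub, Matrix.sub_mul, Matrix.mul_smul, Matrix.mul_one, Matrix.smul_mul,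
    hRR] at this
  convert this using 2
  calc ρ = (R * invSqrt σ * ρ) * (invSqrt σ * R) := by rw [hPρ, hρP]
    _ = _ := by simp only [Matrix.mul_assoc]

/-- A positive definite matrix is `Sᴴ S` for an invertible `S`. -/
theorem exists_isUnit_conjTranspose_mul_self (hσ : σ.PosDef) :
    ∃ S : Matrix Q Q ℂ, IsUnit S ∧ Sᴴ * S = σ := by
  have hc := continuousOn_spectrum σ
  have hsa : IsSelfAdjoint σ := hσ.1
  have hnn : ∀ x ∈ spectrum ℝ σ, 0 ≤ x := by
    rw [hσ.1.spectrum_real_eq_range_eigenvalues]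
    rintro _ ⟨i, rfl⟩
    exact hσ.posSemidef.eigenvalues_nonneg i
  have hRR : cfc Real.sqrt σ * cfc Real.sqrt σ = σ := by
    rw [← cfc_mul _ _ σ (hc _) (hc _)]
    conv_rhs => rw [← cfc_id ℝ σ]
    exact cfc_congr fun x hx => Real.mul_self_sqrt (hnn x hx)
  refine ⟨cfc Real.sqrt σ, ?_, ?_⟩
  · exact isUnit_of_mul_isUnit_left (y := cfc Real.sqrt σ) (by rw [hRR]; exact hσ.isUnit)
  · rw [show (cfc Real.sqrt σ)ᴴ = cfc Real.sqrt σ from cfc_predicate Real.sqrt σ, hRR]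

end sqrtMatrices

/-! ### The trace norm of a block-diagonal error -/

theorem frobSq_blockDiagonal {m n o : Type*} [Fintype m] [Fintype n] [Fintype o] [DecidableEq o]
    (W : o → Matrix m n ℂ) : frobSq (Matrix.blockDiagonal W) = ∑ y, frobSq (W y) := by
  rw [← trace_conjTranspose_mul_self_re, Matrix.blockDiagonal_conjTranspose,
    ← Matrix.blockDiagonal_mul, Matrix.trace_blockDiagonal, Complex.re_sum]
  exact Finset.sum_congr rfl fun y _ => trace_conjTranspose_mul_self_re _

theorem isHermitian_sum_smul {ι Q : Type*} [Fintype ι] (c : ι → ℝ) {A : ι → Matrix Q Q ℂ}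
    (hA : ∀ i, (A i).IsHermitian) : (∑ i, (c i : ℂ) • A i).IsHermitian := by
  rw [Matrix.IsHermitian, Matrix.conjTranspose_sum]
  refine Finset.sum_congr rfl fun i _ => ?_
  rw [Matrix.conjTranspose_smul, (hA i).eq, Complex.star_def, Complex.conj_ofReal]

theorem star_dotProduct_sum_smul_mulVec_re {ι Q : Type*} [Fintype ι] [Fintype Q] (c : ι → ℝ)
    (A : ι → Matrix Q Q ℂ) (v : Q → ℂ) :
    (star v ⬝ᵥ (∑ i, (c i : ℂ) • A i) *ᵥ v).re = ∑ i, c i * (star v ⬝ᵥ A i *ᵥ v).re := by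
  rw [Matrix.sum_mulVec, dotProduct_sum, Complex.re_sum]
  refine Finset.sum_congr rfl fun i _ => ?_
  rw [Matrix.smul_mulVec, dotProduct_smul, smul_eq_mul, Complex.re_ofReal_mul]

/-- If the signed sums of the rows of `Δ` are bounded by `K` on the nonnegative vectors with
entries at most `κ` and sum at most two, then `id ⊗ Δ` maps a classical-quantum operator, whose
blocks are at most `κ τ` and sum up to at most `2 τ`, to one of trace norm at most
`√|M| K tr τ`. -/
theorem traceNorm_blockDiagonal_le {Q N M : Type*} [Fintype Q] [DecidableEq Q] [Fintype N]
    [Fintype M] [DecidableEq M] {r : N → Matrix Q Q ℂ} (hr : ∀ x, (r x).PosSemidef)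
    {τ : Matrix Q Q ℂ} (hτ : τ.PosDef) {κ K : ℝ} (hrκ : ∀ x, ((κ : ℂ) • τ - r x).PosSemidef)
    (hr2 : ((2 : ℂ) • τ - ∑ x, r x).PosSemidef) {Δ : M → N → ℝ} (hK : 0 ≤ K)
    (hΔ : ∀ z : M → ℝ, (∀ y, |z y| = 1) → ∀ (w : N → ℝ) (a : ℝ), 0 ≤ a → (∀ x, 0 ≤ w x) →
      (∀ x, w x ≤ κ * a) → ∑ x, w x ≤ 2 * a → |∑ x, (∑ y, z y * Δ y x) * w x| ≤ K * a) :
    traceNorm (Matrix.blockDiagonal fun y => ∑ x, (Δ y x : ℂ) • r x)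
      ≤ √(Fintype.card M) * K * τ.trace.re := by
  obtain ⟨S, hS, hSτ⟩ := exists_isUnit_conjTranspose_mul_self hτ
  obtain ⟨T, hST⟩ := hS.exists_right_inv
  have hTS : T * S = 1 := mul_eq_one_comm.1 hST
  have hST' : Tᴴ * Sᴴ = 1 := by rw [← Matrix.conjTranspose_mul, hST, Matrix.conjTranspose_one]
  have hTS' : Sᴴ * Tᴴ = 1 := by rw [← Matrix.conjTranspose_mul, hTS, Matrix.conjTranspose_one]
  have hTτ : Tᴴ * τ * T = 1 := by
    rw [← hSτ, ← Matrix.mul_assoc, hST', Matrix.one_mul, hST]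
  set ω : N → Matrix Q Q ℂ := fun x => Tᴴ * r x * T with hω
  have hω0 : ∀ x, (ω x).PosSemidef := fun x => (hr x).conjTranspose_mul_mul_same T
  have hωκ : ∀ x, ((κ : ℂ) • 1 - ω x).PosSemidef := fun x => by
    have := (hrκ x).conjTranspose_mul_mul_same T
    rwa [Matrix.mul_sub, Matrix.sub_mul, Matrix.mul_smul, Matrix.smul_mul, hTτ] at this
  have hω2 : ((2 : ℂ) • 1 - ∑ x, ω x).PosSemidef := by
    have := hr2.conjTranspose_mul_mul_same T
    rwa [Matrix.mul_sub, Matrix.sub_mul, Matrix.mul_smul, Matrix.smul_mul, hTτ, Matrix.mul_sum,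
      Matrix.sum_mul] at this
  set B : M → Matrix Q Q ℂ := fun y => ∑ x, (Δ y x : ℂ) • ω x with hB
  have hX : ∀ y, ∑ x, (Δ y x : ℂ) • r x = Sᴴ * (B y * S) := fun y => by
    simp only [hB, hω, Matrix.sum_mul, Matrix.mul_sum, Matrix.smul_mul, Matrix.mul_smul]
    refine Finset.sum_congr rfl fun x _ => ?_
    congr 1
    calc r x = (Sᴴ * Tᴴ) * r x * (T * S) := by rw [hTS', hTS, Matrix.one_mul, Matrix.mul_one]
      _ = _ := by simp only [Matrix.mul_assoc]
  set A := Matrix.blockDiagonal fun y => ∑ x, (Δ y x : ℂ) • r x with hA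
  set S' : Matrix (Q × M) (Q × M) ℂ := Matrix.blockDiagonal fun _ => S with hS'
  set W : Matrix (Q × M) (Q × M) ℂ := Matrix.blockDiagonal fun y => B y * S with hW
  have hAW : A = S'ᴴ * W := by
    rw [hS', hW, Matrix.blockDiagonal_conjTranspose, ← Matrix.blockDiagonal_mul, hA]
    exact congrArg _ (funext hX)
  have hAh : A.IsHermitian := by
    rw [Matrix.IsHermitian, hA, Matrix.blockDiagonal_conjTranspose]
    exact congrArg _ (funext fun y => isHermitian_sum_smul (Δ y) fun x => (hr x).1)
  have hfS : frobSq S = τ.trace.re := by rw [← trace_conjTranspose_mul_self_re, hSτ]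
  obtain ⟨U, hU, hUU, hUA⟩ := exists_traceNorm_eq hAh
  -- `U` is unitary, so only the `|M|` copies of `S` count; this is the source of `√|M|`.
  have hV : frobSq (S' * U) = Fintype.card M * τ.trace.re := by
    rw [← trace_conjTranspose_mul_self_re, Matrix.conjTranspose_mul, hU.eq, Matrix.trace_mul_comm,
      Matrix.mul_assoc, ← Matrix.mul_assoc U U, hUU, Matrix.one_mul, Matrix.trace_mul_comm,
      trace_conjTranspose_mul_self_re, hS', frobSq_blockDiagonal]
    simp [hfS]
  have hWle : frobSq W ≤ K ^ 2 * τ.trace.re := by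
    rw [hW, frobSq_blockDiagonal]
    obtain ⟨z, hz, hle⟩ := exists_signs_sum_frobSq_le Finset.univ fun y => B y * S
    refine hle.trans ?_
    have hC : ∑ y, (z y : ℂ) • (B y * S) = (∑ x, ((∑ y, z y * Δ y x : ℝ) : ℂ) • ω x) * S := by
      simp only [hB, Matrix.sum_mul, Matrix.smul_mul, Finset.smul_sum, smul_smul,
        Complex.ofReal_sum, Complex.ofReal_mul, Finset.sum_smul]
      rw [Finset.sum_comm]
    rw [hC, ← hfS]
    refine frobSq_mul_le (isHermitian_sum_smul _ fun x => (hω0 x).1) hK (fun v => ?_) S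
    rw [star_dotProduct_sum_smul_mulVec_re]
    -- The classical bound is applied to the weight `⟨v, ω x v⟩`, with `a = ‖v‖²`.
    refine hΔ z hz _ _ ?_ (fun x => (hω0 x).re_dotProduct_nonneg v) (fun x => ?_) ?_
    · simpa using (Matrix.PosSemidef.one (n := Q) (R := ℂ)).re_dotProduct_nonneg v
    · have := (hωκ x).re_dotProduct_nonneg v
      simp only [Matrix.sub_mulVec, Matrix.smul_mulVec, Matrix.one_mulVec, dotProduct_sub,
        dotProduct_smul, smul_eq_mul, RCLike.re_eq_complex_re, Complex.sub_re,
        Complex.re_ofReal_mul] at this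
      linarith
    · have := hω2.re_dotProduct_nonneg v
      rw [← Complex.ofReal_ofNat] at this
      simp only [Matrix.sub_mulVec, Matrix.smul_mulVec, Matrix.one_mulVec, dotProduct_sub,
        dotProduct_smul, smul_eq_mul, RCLike.re_eq_complex_re, Complex.sub_re,
        Complex.re_ofReal_mul, Matrix.sum_mulVec, dotProduct_sum, Complex.re_sum] at this
      linarith
  have hτ0 : 0 ≤ τ.trace.re := hfS ▸ frobSq_nonneg S
  calc traceNorm A = ((S' * U)ᴴ * W).trace.re := by
        rw [hUA, hAW, Matrix.conjTranspose_mul, hU.eq, Matrix.mul_assoc]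
    _ ≤ √(frobSq (S' * U)) * √(frobSq W) := trace_conjTranspose_mul_re_le _ _
    _ ≤ √(Fintype.card M * τ.trace.re) * √(K ^ 2 * τ.trace.re) := by
        rw [hV]; gcongr
    _ = √(Fintype.card M) * K * τ.trace.re := by
        rw [Real.sqrt_mul (Nat.cast_nonneg _), Real.sqrt_mul (sq_nonneg K), Real.sqrt_sq hK]
        linear_combination √(Fintype.card M) * K * Real.mul_self_sqrt hτ0

/-! ## The conditional min-entropy -/

theorem sum_kronecker_single_eq_blockDiagonal {Q N : Type*} [Fintype N] [DecidableEq N]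
    (r : N → Matrix Q Q ℂ) :
    ∑ x, r x ⊗ₖ Matrix.single x x (1 : ℂ) = Matrix.blockDiagonal r := by
  ext ⟨i, x⟩ ⟨j, y⟩
  simp only [Matrix.sum_apply, Matrix.kroneckerMap_apply, Matrix.blockDiagonal_apply,
    Matrix.single_apply, mul_ite, mul_one, mul_zero]
  by_cases h : x = y
  · subst h; simp
  · rw [if_neg h]
    exact Finset.sum_eq_zero fun z _ => if_neg fun hz => h (hz.1.symm.trans hz.2)

theorem marginal_blockDiagonal {Q N : Type*} [Fintype N] [DecidableEq N]
    (r : N → Matrix Q Q ℂ) :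
    marginal (Matrix.blockDiagonal r) = ∑ x, r x := by
  ext i j
  simp [marginal, Matrix.sum_apply, Matrix.blockDiagonal_apply]

theorem mulVec_eq_zero_of_sum_mulVec_eq_zero {Q N : Type*} [Fintype Q] [Fintype N]
    {r : N → Matrix Q Q ℂ}
    (hr : ∀ x, (r x).PosSemidef) {v : Q → ℂ} (h : (∑ x, r x) *ᵥ v = 0) (x : N) :
    r x *ᵥ v = 0 := by
  rw [← (hr x).dotProduct_mulVec_zero_iff]
  have h0 : ∑ x, star v ⬝ᵥ r x *ᵥ v = 0 := by
    rw [← dotProduct_sum, ← Matrix.sum_mulVec, h, dotProduct_zero]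
  exact (Finset.sum_eq_zero_iff_of_nonneg fun x _ =>
    (hr x).dotProduct_mulVec_nonneg v).1 h0 x (Finset.mem_univ x)

theorem posSemidef_opNorm_smul_sub {Q N : Type*} [Fintype Q] [Fintype N] [DecidableEq N]
    [DecidableEq Q] {r : N → Matrix Q Q ℂ}
    (hr : ∀ x, (r x).PosSemidef) {σ : Matrix Q Q ℂ} (hσ : IsState σ)
    (hker : ∀ v : Q → ℂ, σ *ᵥ v = 0 → marginal (Matrix.blockDiagonal r) *ᵥ v = 0) (x : N) :
    ((opNorm ((invSqrt σ ⊗ₖ (1 : Matrix N N ℂ)) * Matrix.blockDiagonal r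
      * (invSqrt σ ⊗ₖ (1 : Matrix N N ℂ))) : ℂ) • σ - r x).PosSemidef := by
  rw [Matrix.kronecker_one, ← Matrix.blockDiagonal_mul, ← Matrix.blockDiagonal_mul]
  have hIh : (invSqrt σ)ᴴ = invSqrt σ := cfc_predicate (fun t : ℝ => (√t)⁻¹) σ
  refine posSemidef_smul_sub_of_invSqrt hσ.1 (hr x).1 (fun v hv => ?_) ?_
  · have := hker v hv
    rw [marginal_blockDiagonal] at this
    exact mulVec_eq_zero_of_sum_mulVec_eq_zero hr this x
  · have hh : (Matrix.blockDiagonal fun x => invSqrt σ * r x * invSqrt σ).IsHermitian := by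
      rw [Matrix.IsHermitian, Matrix.blockDiagonal_conjTranspose]
      refine congrArg _ (funext fun x => ?_)
      rw [Matrix.conjTranspose_mul, Matrix.conjTranspose_mul, hIh, (hr x).1.eq, Matrix.mul_assoc]
    convert (posSemidef_opNorm_smul_one_sub hh).submatrix (fun i : Q => (i, x)) using 1
    ext i j
    simp only [Matrix.sub_apply, Matrix.smul_apply, Matrix.submatrix_apply, Matrix.one_apply,
      Prod.mk.injEq, and_true, Matrix.blockDiagonal_apply_eq]

/-- Take the trace of `∑ x, (t σ - r x) ≥ 0`. This keeps the infimum in the entropy positive and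
`|N| b` away from `1`. -/
theorem one_le_card_mul {Q N : Type*} [Fintype Q] [Fintype N]
    {r : N → Matrix Q Q ℂ} (htr : (∑ x, r x).trace = 1) {σ : Matrix Q Q ℂ}
    (hσ : IsState σ) {t : ℝ} (h : ∀ x, ((t : ℂ) • σ - r x).PosSemidef) :
    1 ≤ Fintype.card N * t := by
  have h1 := Finset.sum_nonneg fun x (_ : x ∈ Finset.univ) => (h x).trace_nonneg
  simp only [Matrix.trace_sub, Matrix.trace_smul, hσ.2, Finset.sum_sub_distrib,
    ← Matrix.trace_sum, htr, smul_eq_mul, mul_one, Finset.sum_const, Finset.card_univ,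
    nsmul_eq_mul] at h1
  have := (Complex.le_def.1 h1).1
  simpa using this

/-- A lower bound on the conditional min-entropy provides a state that dominates the blocks. -/
theorem exists_state_of_le_condMinEntropy {Q N : Type*} [Fintype Q] [Fintype N] [DecidableEq N]
    [DecidableEq Q] {ρ : Matrix (Q × N) (Q × N) ℂ}
    (hρ : IsCQState ρ) {l : ℝ} (hl : l ≤ condMinEntropy ρ) {c : ℝ} (hc : 1 < c) :
    ∃ (r : N → Matrix Q Q ℂ) (σ : Matrix Q Q ℂ) (t : ℝ), (∀ x, (r x).PosSemidef) ∧
      ρ = Matrix.blockDiagonal r ∧ (∑ x, r x).trace = 1 ∧ IsState σ ∧ t ≤ c * (2 : ℝ) ^ (-l) ∧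
      1 ≤ Fintype.card N * t ∧ ∀ x, ((t : ℂ) • σ - r x).PosSemidef := by
  obtain ⟨⟨hρ0, hρ1⟩, r, hr, rfl⟩ := hρ
  rw [sum_kronecker_single_eq_blockDiagonal] at *
  have htr : (∑ x, r x).trace = 1 := by
    rwa [Matrix.trace_blockDiagonal, ← Matrix.trace_sum] at hρ1
  unfold condMinEntropy at hl
  set T := {t : ℝ | ∃ σ : Matrix Q Q ℂ, IsState σ ∧
    (∀ v : Q → ℂ, σ *ᵥ v = 0 → marginal (Matrix.blockDiagonal r) *ᵥ v = 0) ∧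
    t = opNorm ((invSqrt σ ⊗ₖ (1 : Matrix N N ℂ)) * Matrix.blockDiagonal r
      * (invSqrt σ ⊗ₖ (1 : Matrix N N ℂ)))} with hT
  have hTle : ∀ t ∈ T, 1 ≤ Fintype.card N * t := by
    rintro _ ⟨σ, hσ, hker, rfl⟩
    exact one_le_card_mul htr hσ (posSemidef_opNorm_smul_sub hr hσ hker)
  have hne : T.Nonempty :=
    ⟨_, marginal (Matrix.blockDiagonal r), ⟨by
      rw [marginal_blockDiagonal]; exact Matrix.posSemidef_sum _ fun x _ => hr x, by
      rwa [marginal_blockDiagonal]⟩, fun v hv => hv, rfl⟩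
  have hN : (0 : ℝ) < Fintype.card N := by
    obtain ⟨t, ht⟩ := hne
    refine lt_of_le_of_ne (Nat.cast_nonneg _) fun h => ?_
    have := hTle t ht
    rw [← h] at this
    norm_num at this
  have hI : (Fintype.card N : ℝ)⁻¹ ≤ sInf T := le_csInf hne fun t ht => by
    rw [inv_le_iff_one_le_mul₀ hN, mul_comm]; exact hTle t ht
  have hI0 : 0 < sInf T := (inv_pos.2 hN).trans_le hI
  have hI2 : sInf T ≤ (2 : ℝ) ^ (-l) :=
    (Real.logb_le_iff_le_rpow one_lt_two hI0).1 (by linarith)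
  -- The slack `c > 1` avoids proving that the infimum is attained.
  have hlt : sInf T < c * (2 : ℝ) ^ (-l) :=
    hI2.trans_lt (lt_mul_of_one_lt_left (Real.rpow_pos_of_pos two_pos _) hc)
  obtain ⟨t, ht, htlt⟩ := exists_lt_of_csInf_lt hne hlt
  have h1 := hTle t ht
  obtain ⟨σ, hσ, hker, rfl⟩ := ht
  exact ⟨r, σ, _, hr, rfl, htr, hσ, htlt.le, h1, posSemidef_opNorm_smul_sub hr hσ hker⟩

/-! ### Assembling the theorem -/

theorem output_sub_eq_blockDiagonal {D N M Q : Type*} [Fintype D] [Fintype N] [DecidableEq N]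
    [Fintype M] [DecidableEq M] [Fintype Q] (f : D → N → M) (r : N → Matrix Q Q ℂ) :
    (1 / (Fintype.card D : ℂ)) • ∑ s, idTensor (funMatrix ℂ (f s)) (Matrix.blockDiagonal r)
      - marginal (Matrix.blockDiagonal r) ⊗ₖ maxMixed M
      = Matrix.blockDiagonal fun y => ∑ x, (bias f y x : ℂ) • r x := by
  ext ⟨i, y⟩ ⟨j, y'⟩
  rw [marginal_blockDiagonal]
  by_cases h : y = y'
  · subst h
    simp only [idTensor, funMatrix, maxMixed, bias, Matrix.sub_apply, Matrix.smul_apply,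
      Matrix.sum_apply, Matrix.of_apply, Matrix.kroneckerMap_apply, Matrix.blockDiagonal_apply,
      Matrix.one_apply, if_true, smul_eq_mul, Complex.ofReal_sub, Complex.ofReal_mul,
      Complex.ofReal_sum, sub_mul, Finset.sum_sub_distrib, Finset.sum_mul, Finset.mul_sum]
    congr 1
    · rw [Finset.sum_comm]
      refine Finset.sum_congr rfl fun x _ => Finset.sum_congr rfl fun s _ => ?_
      split_ifs <;> simp
    · refine Finset.sum_congr rfl fun x _ => ?_
      push_cast
      ring
  · simp [idTensor, maxMixed, Matrix.sum_apply, Matrix.blockDiagonal_apply, h]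

/-- Every `(k, ε)`-extractor is a quantum-proof `(k + 1, 6 √|M| ε)`-extractor. -/
theorem IsExtractor.isQuantumProofExtractor {D N M : Type*} [Fintype D] [Fintype N]
    [DecidableEq N] [Fintype M] [DecidableEq M] {f : D → N → M} {k ε : ℝ}
    (hf : IsExtractor f k ε) :
    IsQuantumProofExtractor f (k + 1) (6 * √(Fintype.card M) * ε) := by
  intro q ρ hρ hk
  obtain ⟨r, σ, t, hr, rfl, htr, hσ, ht, hNt, hσr⟩ :=
    exists_state_of_le_condMinEntropy hρ hk (c := 11 / 10) (by norm_num)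
  rw [output_sub_eq_blockDiagonal]
  have hq : (0 : ℝ) < q := by
    rcases Nat.eq_zero_or_pos q with rfl | h
    · simp [Matrix.trace] at htr
    · exact_mod_cast h
  have htpos : 0 < t := by
    by_contra h
    have := mul_nonneg (Nat.cast_nonneg (α := ℝ) (Fintype.card N)) (neg_nonneg.2 (not_lt.1 h))
    linarith
  set b : ℝ := (2 : ℝ) ^ (-k) with hb
  have hb2 : (2 : ℝ) ^ (-(k + 1)) = b / 2 := by
    rw [neg_add, Real.rpow_add two_pos, Real.rpow_neg_one, hb]; ring
  rw [hb2] at ht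
  -- From `1 ≤ |N| t` and `t ≤ (11 / 20) b`.
  have hNb : 20 / 11 ≤ Fintype.card N * b := by
    have := mul_le_mul_of_nonneg_left ht (Nat.cast_nonneg (α := ℝ) (Fintype.card N))
    linarith
  have hcl : ∀ z : M → ℝ, (∀ y, |z y| = 1) → ∀ (w : N → ℝ) (a : ℝ), 0 ≤ a → (∀ x, 0 ≤ w x) →
      (∀ x, w x ≤ (11 / 10 * b) * a) → ∑ x, w x ≤ 2 * a →
      |∑ x, (∑ y, z y * bias f y x) * w x| ≤ 44 / 9 * ε * a := fun z hz w a ha h0 h1 h2 =>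
    abs_sum_le_of_bounded_on_probDist_of_scale
      (fun P hP h => hf.abs_sum_signed_bias_le hz hP h) hNb ha h0 h1 h2
  have hε : 0 ≤ ε := by
    have := (abs_nonneg _).trans
      (hcl (fun _ => 1) (by simp) (fun _ => 0) 1 zero_le_one (fun _ => le_rfl)
        (fun _ => by positivity) (by simp))
    linarith
  -- The term `η • 1` makes `τ` invertible and adds only `1 / 10` to its trace.
  set η : ℝ := 1 / (10 * q) with hη
  have hη0 : 0 < η := by positivity
  have hρQ : (∑ x, r x).PosSemidef := Matrix.posSemidef_sum _ fun x _ => hr x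
  have hsmul : ∀ {A : Matrix (Fin q) (Fin q) ℂ} {c : ℝ}, 0 ≤ c → A.PosSemidef →
      ((c : ℂ) • A).PosSemidef := fun hc hA => hA.smul (by exact_mod_cast hc)
  set τ : Matrix (Fin q) (Fin q) ℂ :=
    ((1 / 2 : ℝ) : ℂ) • (σ + ∑ x, r x) + (η : ℂ) • 1 with hτ
  have hτpos : τ.PosDef :=
    Matrix.PosDef.posSemidef_add (hsmul (by norm_num) (hσ.1.add hρQ))
      (Matrix.PosDef.one.smul (by exact_mod_cast hη0))
  have hτtr : τ.trace.re = 11 / 10 := by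
    rw [hτ, Matrix.trace_add, Matrix.trace_smul, Matrix.trace_add, hσ.2, htr, Matrix.trace_smul,
      Matrix.trace_one, Fintype.card_fin]
    simp [hη]
    field_simp
    norm_num
  have hκ : ∀ x, (((11 / 10 * b : ℝ) : ℂ) • τ - r x).PosSemidef := fun x => by
    have h1 := hsmul (sub_nonneg.2 (show 2 * t ≤ 11 / 10 * b by linarith)) hτpos.posSemidef
    have h2 := hsmul htpos.le hρQ
    have h3 := hsmul (by positivity : 0 ≤ 2 * t * η) (Matrix.PosSemidef.one (n := Fin q) (R := ℂ))
    convert (h1.add h2).add (h3.add (hσr x)) using 1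
    -- The decomposition rests on `2 t τ = t σ + t ρ_Q + 2 t η`.
    rw [hτ]
    push_cast
    module
  have h2τ : ((2 : ℂ) • τ - ∑ x, r x).PosSemidef := by
    have h3 := hsmul (by positivity : 0 ≤ 2 * η) (Matrix.PosSemidef.one (n := Fin q) (R := ℂ))
    convert h3.add hσ.1 using 1
    rw [hτ]
    push_cast
    module
  have := traceNorm_blockDiagonal_le hr hτpos hκ h2τ (by positivity) hcl
  rw [hτtr] at this
  refine this.trans ?_
  -- The constant is `44 / 9 * 11 / 10 = 242 / 45 < 6`.
  nlinarith [mul_nonneg (Real.sqrt_nonneg (Fintype.card M)) hε]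

end QExt

theorem mainTheorem9 (n m d : ℕ) (k ε : ℝ) (f : BitString d → BitString n → BitString m)
    (hf : QExt.IsExtractor f k ε) :
    QExt.IsQuantumProofExtractor f (k + 1) (6 * √((2 : ℝ) ^ m) * ε) := by
  have hcard : (Fintype.card (BitString m) : ℝ) = 2 ^ m := by simp [BitString]
  rw [← hcard]
  exact hf.isQuantumProofExtractor
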